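/- Let $E$ be a finite set. A family $\mathcal{G}'$ of subsets of $E$ is called a $G'_2$-family if 1. for every $e\in E$, $\{e\}\in\mathcal{G}'$ and $E\setminus\{e\}\notin\mathcal{G}'$; 2. for all $G,H\in\mathcal{G}'$ with $G\cap H\neq\emptyset$ and $G\cup H\neq E$ we have $G\cap H\in\mathcal{G}'$, and if moreover $G\cup H\neq E\setminus\{e\}$ for every $e\in E$, then also $G\cup H\in\mathcal{G}'$; 3. $|E|=2g_0$ for some integer $g_0$; 4. every $G_i\in\mathcal{G}'$ has cardinality $|G_i|=2g_i-1$ for some integer $g_i$. Given such a family, let $\tilde{\mathcal{G}}'$ be the family of all nonempty sets that are intersections of sets from $\mathcal{G}'$ (the intersection of no sets being $E$). For $F\in\tilde{\mathcal{G}}'$ let $c'(F)$ be the least $k\geq 0$ such that $F$ is the intersection of $k$ sets from $\mathcal{G}'$, and let $r'(F)=\frac12(|F|+c'(F))$. Let $\mathfrak{C}_{\mathcal{G}'}$ be the family of inclusion-minimal sets among all $(r'(F)+1)$-element subsets of $F$, over all $F\in\tilde{\mathcal{G}}'$. A matroid is connected if every two distinct elements of its ground set belong to a common circuit. A good flat of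 a matroid $M$ on $E$ is a flat $G$ with $\emptyset\neq G\subsetneq E$ such that both the restriction $M|G$ and the contraction $M/G$ are connected. **Theorem.** Let $\mathcal{G}'$ be a $G'_2$-family on $E$. Then there is a unique matroid $M_{\mathcal{G}'}$ on the ground set $E$ whose set of circuits is $\mathfrak{C}_{\mathcal{G}'}$. This matroid is connected, the set of its good flats is equal to $\mathcal{G}'$, every $G_i\in\mathcal{G}'$ has rank $g_i$ in $M_{\mathcal{G}'}$, and $E$ has rank $g_0$. -/

import Mathlib

open scoped Matroid

/-- A family `𝒢` of subsets of the finite ground set `E` (taken to be a whole type; `{e}ᶜ` is the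
set `E ∖ e`) is a `G'₂`-family. -/
structure IsG2PrimeFamily {E : Type*} (𝒢 : Set (Set E)) : Prop where
  singleton_mem : ∀ e : E, ({e} : Set E) ∈ 𝒢
  compl_singleton_notMem : ∀ e : E, ({e}ᶜ : Set E) ∉ 𝒢
  inter_mem : ∀ G ∈ 𝒢, ∀ H ∈ 𝒢, (G ∩ H).Nonempty → G ∪ H ≠ Set.univ → G ∩ H ∈ 𝒢
  union_mem : ∀ G ∈ 𝒢, ∀ H ∈ 𝒢, (G ∩ H).Nonempty → G ∪ H ≠ Set.univ →
    (∀ e : E, G ∪ H ≠ {e}ᶜ) → G ∪ H ∈ 𝒢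
  card_ground : ∃ g₀ : ℕ, Nat.card E = 2 * g₀
  card_mem : ∀ G ∈ 𝒢, ∃ g : ℕ, (G.ncard : ℤ) = 2 * (g : ℤ) - 1

namespace G2Prime

/-- `F` is the intersection, in the ground set `E`, of `k` sets from `𝒢`; for `k = 0` the
intersection is `E` itself. -/
def IsInterOf {E : Type*} (𝒢 : Set (Set E)) (k : ℕ) (F : Set E) : Prop :=
  ∃ S : Finset (Set E), (S : Set (Set E)) ⊆ 𝒢 ∧ S.card = k ∧ ⋂₀ (S : Set (Set E)) = F

/-- The nonempty sets that are intersections of sets from `𝒢`. -/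
def tilde {E : Type*} (𝒢 : Set (Set E)) : Set (Set E) :=
  {F | F.Nonempty ∧ ∃ k : ℕ, IsInterOf 𝒢 k F}

/-- The least `k` such that `F` is the intersection of `k` sets from `𝒢`. Used only for
`F ∈ tilde 𝒢`, where such a `k` exists. -/
noncomputable def c {E : Type*} (𝒢 : Set (Set E)) (F : Set E) : ℕ :=
  sInf {k : ℕ | IsInterOf 𝒢 k F}

/-- The number `(|F| + c(F)) / 2`, as a rational number. Used only for `F ∈ tilde 𝒢`. -/
noncomputable def r {E : Type*} (𝒢 : Set (Set E)) (F : Set E) : ℚ :=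
  ((F.ncard : ℚ) + (c 𝒢 F : ℚ)) / 2

/-- `C` is an `(r(F) + 1)`-element subset of `F`, for some `F ∈ tilde 𝒢`. -/
def IsCandidate {E : Type*} (𝒢 : Set (Set E)) (C : Set E) : Prop :=
  ∃ F ∈ tilde 𝒢, C ⊆ F ∧ (C.ncard : ℚ) = r 𝒢 F + 1

/-- The inclusion-minimal sets among all `(r(F) + 1)`-element subsets of `F`, over all
`F ∈ tilde 𝒢`. -/
def circuits {E : Type*} (𝒢 : Set (Set E)) : Set (Set E) :=
  {C | Minimal (IsCandidate 𝒢) C}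

/-- `M` is a matroid on the ground set `E` whose set of circuits is `circuits 𝒢`. -/
structure IsMatroidOf {E : Type*} (𝒢 : Set (Set E)) (M : Matroid E) : Prop where
  ground_eq : M.E = Set.univ
  isCircuit_iff : ∀ C : Set E, M.IsCircuit C ↔ C ∈ circuits 𝒢

end G2Prime

/-- A matroid is connected if every two distinct elements belong to a common circuit. -/
def IsConnectedMatroid {α : Type*} (M : Matroid α) : Prop :=
  ∀ e ∈ M.E, ∀ f ∈ M.E, e ≠ f → ∃ C, M.IsCircuit C ∧ e ∈ C ∧ f ∈ C

/-- A (proper) good flat: a flat `∅ ≠ G ⊊ E` such that both the restriction of `M` to `G` and the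
contraction of `G` in `M` are connected. -/
structure IsGoodFlat {α : Type*} (M : Matroid α) (G : Set α) : Prop where
  isFlat : M.IsFlat G
  nonempty : G.Nonempty
  ssubset_ground : G ⊂ M.E
  restrict_connected : IsConnectedMatroid (M ↾ G)
  contract_connected : IsConnectedMatroid (M ／ G)

/-! Pass to complements. Those of members of `𝒢`, with all singletons adjoined, form a family of odd
sets that is closed under union and intersection of two meeting members whose union is not
everything. Uncrossing (`IsPart.exists_union_inter`) therefore makes the least number of parts in a
partition of `Xᶜ` into such sets submodular on sets `X` with a common point, and parity makes `|X| +
n` even. For an independent `I`, tight sets that meet thus have a tight union. If no element of `J \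
I` can be added to `I`, each lies in a tight set; the union of the tight sets splits into disjoint
ones, each containing at least as many elements of `I` as of `J`, so `|J| ≤ |I|`. This is
augmentation, hence a matroid.

Its circuits are the prescribed ones: singleton parts can be discarded when testing the bound, and
the least number of parts for an intersection `F` of members of `𝒢` is `c 𝒢 F`.

Splitting a set into sets tight for a basis gives `|A| ≤ 2 r(A)`, strictly for nonempty proper `A`,
with `2 r(E) = |E|` and `2 r(G) = |G| + 1` for `G ∈ 𝒢`. These inequalities exclude every separator
of `M`, `M ↾ G` and `M ／ G`. Conversely, for a good flat `F`, connectedness of `M ↾ F` makes `F`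
tight, and connectedness of `M ／ F` leaves only one part in `Fᶜ`; that part is not a singleton,
since `F` would then have full rank. -/

namespace Matroid

/-! ### Rank, circuits and separators in finite matroids -/

variable {α : Type*}

/-- The rank of a set in a matroid as a natural number. -/
noncomputable def natRk (M : Matroid α) (X : Set α) : ℕ := (M.eRk X).toNat

lemma cast_natRk [Finite α] (M : Matroid α) (X : Set α) : (M.natRk X : ℕ∞) = M.eRk X := by
  refine ENat.natCast_toNat ?_
  have h := M.eRk_le_encard X
  have h' : X.encard < ⊤ := (Set.toFinite X).encard_lt_top
  exact (h.trans_lt h').ne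

lemma IsBasis.natRk_eq {M : Matroid α} {I X : Set α} (hI : M.IsBasis I X) :
    M.natRk X = I.ncard := by
  rw [natRk, hI.eRk_eq_encard, Set.ncard]

lemma Indep.ncard_le_natRk [Finite α] {M : Matroid α} {I X : Set α} (hI : M.Indep I)
    (hIX : I ⊆ X) : I.ncard ≤ M.natRk X := by
  have h := hI.encard_le_eRk_of_subset hIX
  rw [← cast_natRk, ← (Set.toFinite I).cast_ncard_eq] at h
  exact_mod_cast h

lemma natRk_union_le [Finite α] (M : Matroid α) (X Y : Set α) :
    M.natRk (X ∪ Y) ≤ M.natRk X + M.natRk Y := by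
  have h := M.eRk_union_le_eRk_add_eRk X Y
  simp only [← cast_natRk] at h
  exact_mod_cast h

lemma natRk_contract_add [Finite α] (M : Matroid α) {C X : Set α} (hC : C ⊆ M.E)
    (hX : X ⊆ M.E) (hXC : Disjoint X C) :
    (M ／ C).natRk X + M.natRk C = M.natRk (X ∪ C) := by
  obtain ⟨I, hI⟩ := M.exists_isBasis C
  obtain ⟨K, hK, hIK⟩ := hI.indep.subset_isBasis_of_subset
    (hI.subset.trans (Set.subset_union_right (s := X))) (Set.union_subset hX hC)
  have hKC : K ∩ C = I := (hI.eq_of_subset_indep (hK.indep.subset Set.inter_subset_left)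
    (Set.subset_inter hIK hI.subset) Set.inter_subset_right).symm
  have hind : M.Indep (K \ C ∪ I) :=
    hK.indep.subset (Set.union_subset Set.sdiff_subset hIK)
  have h := hK.contract_isBasis hI hind
  have hX' : (X ∪ C) \ C = X := by
    rw [Set.union_sdiff_right, hXC.sdiff_eq_left]
  rw [hX'] at h
  rw [h.natRk_eq, hI.natRk_eq, hK.natRk_eq, ← hKC]
  rw [add_comm, Set.ncard_inter_add_ncard_sdiff_eq_ncard K C]

/-- Sharing a circuit with a common element is a transitive relation. -/
lemma exists_isCircuit_of_inter_nonempty [Finite α] (M : Matroid α) {e g : α} :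
    ∀ (n : ℕ) {C₁ C₂ : Set α}, M.IsCircuit C₁ → M.IsCircuit C₂ → e ∈ C₁ → g ∈ C₂ →
      (C₁ ∩ C₂).Nonempty → (C₁ ∪ C₂).ncard = n → ∃ C, M.IsCircuit C ∧ e ∈ C ∧ g ∈ C := by
  intro n
  induction n using Nat.strong_induction_on with
  | _ n ih =>
  intro C₁ C₂ h₁ h₂ he hg ⟨f, hf₁, hf₂⟩ hn
  by_contra hcon
  have he₂ : e ∉ C₂ := fun h ↦ hcon ⟨C₂, h₂, h, hg⟩
  have hg₁ : g ∉ C₁ := fun h ↦ hcon ⟨C₁, h₁, he, h⟩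
  obtain ⟨C₃, hC₃, h₃, he₃⟩ := h₁.strong_elimination h₂ hf₁ hf₂ he he₂
  obtain ⟨C₄, hC₄, h₄, hg₄⟩ := h₂.strong_elimination h₁ hf₂ hf₁ hg hg₁
  have hf₃ : f ∉ C₃ := fun h ↦ (hC₃ h).2 rfl
  have hf₄ : f ∉ C₄ := fun h ↦ (hC₄ h).2 rfl
  have h32 : (C₃ ∩ C₂).Nonempty := by
    by_contra hne
    have : C₃ ⊆ C₁ := fun x hx ↦ (hC₃ hx).1.resolve_right fun hx2 ↦ hne ⟨x, hx, hx2⟩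
    exact hf₃ (h₃.eq_of_subset_isCircuit h₁ this ▸ hf₁)
  have h41 : (C₁ ∩ C₄).Nonempty := by
    by_contra hne
    have : C₄ ⊆ C₂ := fun x hx ↦ (hC₄ hx).1.resolve_right fun hx2 ↦ hne ⟨x, hx2, hx⟩
    exact hf₄ (h₄.eq_of_subset_isCircuit h₂ this ▸ hf₂)
  -- By induction no meeting pair joining `e` to `g` has a smaller union. The pair `C₃`, `C₄` will
  -- violate this, since neither contains `f`.
  have key : ∀ {D₁ D₂ : Set α}, M.IsCircuit D₁ → M.IsCircuit D₂ → e ∈ D₁ → g ∈ D₂ →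
      (D₁ ∩ D₂).Nonempty → D₁ ∪ D₂ ⊆ C₁ ∪ C₂ → C₁ ∪ C₂ ⊆ D₁ ∪ D₂ := by
    intro D₁ D₂ hD₁ hD₂ heD hgD hne hsub
    by_contra hnot
    exact hcon (ih _ (hn ▸ Set.ncard_lt_ncard ⟨hsub, hnot⟩) hD₁ hD₂ heD hgD hne rfl)
  have k32 := key h₃ h₂ he₃ hg h32
    (Set.union_subset (fun x hx ↦ (hC₃ hx).1) Set.subset_union_right)
  have hne : (C₃ ∩ C₄).Nonempty := by
    by_contra hne
    have : C₄ ⊆ C₂ := by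
      intro x hx
      refine (hC₄ hx).1.resolve_right fun hx1 ↦ ?_
      by_cases hx2 : x ∈ C₂
      · have : C₄ ⊆ C₂ := by
          intro y hy
          rcases k32 ((hC₄ hy).1.symm) with h | h
          · exact absurd ⟨y, h, hy⟩ hne
          · exact h
        exact hf₄ (h₄.eq_of_subset_isCircuit h₂ this ▸ hf₂)
      · exact hne ⟨x, (k32 (Or.inl hx1)).resolve_right hx2, hx⟩
    exact hf₄ (h₄.eq_of_subset_isCircuit h₂ this ▸ hf₂)
  have k34 := key h₃ h₄ he₃ hg₄ hne
    (Set.union_subset (fun x hx ↦ (hC₃ hx).1) (fun x hx ↦ (hC₄ hx).1.symm))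
  exact (k34 (Or.inl hf₁)).elim hf₃ hf₄

/-- A finite matroid without a nontrivial separator is connected. -/
lemma isConnectedMatroid_of_forall_lt [Finite α] (M : Matroid α)
    (h : ∀ A B : Set α, A.Nonempty → B.Nonempty → Disjoint A B → A ∪ B = M.E →
      M.natRk M.E < M.natRk A + M.natRk B) : IsConnectedMatroid M := by
  intro e he f hf hef
  by_contra hcon
  -- The component of `e`: no circuit meets both it and its complement, so bases of the two sides
  -- have an independent union.
  let A : Set α := {x ∈ M.E | x = e ∨ ∃ C, M.IsCircuit C ∧ e ∈ C ∧ x ∈ C}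
  let B : Set α := M.E \ A
  have hAE : A ⊆ M.E := fun x hx ↦ hx.1
  have hlt := h A B ⟨e, he, Or.inl rfl⟩
    ⟨f, hf, fun h ↦ h.2.elim (fun h ↦ hef h.symm) hcon⟩ Set.disjoint_sdiff_right
    (Set.union_sdiff_cancel hAE)
  obtain ⟨I, hI⟩ := M.exists_isBasis A
  obtain ⟨J, hJ⟩ := M.exists_isBasis B
  have hIJ : M.Indep (I ∪ J) := by
    rw [indep_iff_forall_subset_not_isCircuit
      (Set.union_subset hI.indep.subset_ground hJ.indep.subset_ground)]
    intro C hC hCc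
    have hCA : ¬ C ⊆ A := fun hCA ↦ hCc.not_indep (hI.indep.subset fun x hx ↦
      (hC hx).resolve_right fun hxJ ↦ (hJ.subset hxJ).2 (hCA hx))
    have hCB : ¬ C ⊆ B := fun hCB ↦ hCc.not_indep (hJ.indep.subset fun x hx ↦
      (hC hx).resolve_left fun hxI ↦ (hCB hx).2 (hI.subset hxI))
    obtain ⟨y, hyC, hyA⟩ := Set.not_subset.1 hCA
    obtain ⟨x, hxC, hxB⟩ := Set.not_subset.1 hCB
    have hxA : x ∈ A := by
      by_contra hxA
      exact hxB ⟨hCc.subset_ground hxC, hxA⟩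
    refine hyA ⟨hCc.subset_ground hyC, Or.inr ?_⟩
    obtain ⟨-, rfl | ⟨D, hD, heD, hxD⟩⟩ := hxA
    · exact ⟨C, hCc, hxC, hyC⟩
    · exact M.exists_isCircuit_of_inter_nonempty _ hD hCc heD hyC ⟨x, hxD, hxC⟩ rfl
  have hdis : Disjoint I J := Set.disjoint_sdiff_right.mono hI.subset hJ.subset
  have := hIJ.ncard_le_natRk hIJ.subset_ground
  rw [Set.ncard_union_eq hdis, ← hI.natRk_eq, ← hJ.natRk_eq] at this
  omega

end Matroid

/-- A connected finite matroid has no nontrivial separator. -/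
lemma IsConnectedMatroid.natRk_lt_add {α : Type*} [Finite α] {M : Matroid α}
    (hM : IsConnectedMatroid M) {A B : Set α} (hA : A.Nonempty) (hB : B.Nonempty)
    (hAB : Disjoint A B) (hE : A ∪ B = M.E) : M.natRk M.E < M.natRk A + M.natRk B := by
  by_contra hle
  obtain ⟨e, he⟩ := hA
  obtain ⟨f, hf⟩ := hB
  have hAE : A ⊆ M.E := hE ▸ Set.subset_union_left
  have hBE : B ⊆ M.E := hE ▸ Set.subset_union_right
  obtain ⟨C, hC, heC, hfC⟩ := hM e (hAE he) f (hBE hf) (hAB.ne_of_mem he hf)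
  have hCA : M.Indep (C ∩ A) := hC.ssubset_indep
    ⟨Set.inter_subset_left, fun h ↦ hAB.ne_of_mem (h hfC).2 hf rfl⟩
  have hCB : M.Indep (C ∩ B) := hC.ssubset_indep
    ⟨Set.inter_subset_left, fun h ↦ hAB.ne_of_mem he (h heC).2 rfl⟩
  -- If ranks added up, the union of these two bases would be independent, yet it contains the
  -- circuit `C`.
  obtain ⟨I, hI, hCI⟩ := hCA.subset_isBasis_of_subset Set.inter_subset_right hAE
  obtain ⟨J, hJ, hCJ⟩ := hCB.subset_isBasis_of_subset Set.inter_subset_right hBE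
  have hIJE : I ∪ J ⊆ M.E := Set.union_subset hI.indep.subset_ground hJ.indep.subset_ground
  have hrk : M.eRk M.E = M.eRk (I ∪ J) := by
    rw [hI.eRk_eq_eRk_union, Set.union_comm, hJ.eRk_eq_eRk_union, Set.union_comm, hE]
  have hcard : (I ∪ J).ncard ≤ M.natRk (I ∪ J) := by
    have h1 := Set.ncard_union_le I J
    rw [← hI.natRk_eq, ← hJ.natRk_eq] at h1
    have h2 : M.natRk M.E = M.natRk (I ∪ J) := by rw [Matroid.natRk, hrk, Matroid.natRk]
    omega
  have hind : M.Indep (I ∪ J) := by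
    rw [Matroid.indep_iff_eRk_eq_encard_of_finite (Set.toFinite _)]
    refine le_antisymm (M.eRk_le_encard _) ?_
    rw [← Matroid.cast_natRk, ← (Set.toFinite (I ∪ J)).cast_ncard_eq]
    exact_mod_cast hcard
  refine hC.not_indep (hind.subset fun x hx ↦ ?_)
  have hxE := hC.subset_ground hx
  rw [← hE] at hxE
  exact hxE.imp (fun h ↦ hCI ⟨hx, h⟩) (fun h ↦ hCJ ⟨hx, h⟩)

namespace G2Prime

/-! ### Partitions into members of a crossing family -/

variable {E : Type*}

/-- `A` is the disjoint union of `n` members of `𝒟`. -/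
inductive IsPart (𝒟 : Set (Set E)) : ℕ → Set E → Prop
  | empty : IsPart 𝒟 0 ∅
  | union_of_disjoint {n : ℕ} {A D : Set E} :
      IsPart 𝒟 n A → D ∈ 𝒟 → Disjoint A D → IsPart 𝒟 (n + 1) (A ∪ D)

namespace IsPart

variable {𝒟 : Set (Set E)} {m n : ℕ} {A B D U : Set E}

lemma of_mem (hD : D ∈ 𝒟) : IsPart 𝒟 1 D := by
  simpa using IsPart.empty.union_of_disjoint hD (Set.empty_disjoint D)

lemma mono {𝒟' : Set (Set E)} (h : IsPart 𝒟 n A) (h𝒟 : 𝒟 ⊆ 𝒟') : IsPart 𝒟' n A := by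
  induction h with
  | empty => exact .empty
  | union_of_disjoint _ hD hdis ih => exact ih.union_of_disjoint (h𝒟 hD) hdis

lemma union (hA : IsPart 𝒟 m A) (hB : IsPart 𝒟 n B) (hAB : Disjoint A B) :
    IsPart 𝒟 (m + n) (A ∪ B) := by
  induction hB with
  | empty => simpa using hA
  | union_of_disjoint _ hD hdis ih =>
    rw [Set.disjoint_union_right] at hAB
    rw [← Set.union_assoc]
    exact (ih hAB.1).union_of_disjoint hD (Set.disjoint_union_left.2 ⟨hAB.2, hdis⟩)

lemma of_singleton_mem [Finite E] (h𝒟 : ∀ e : E, {e} ∈ 𝒟) (A : Set E) :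
    IsPart 𝒟 A.ncard A := by
  induction A, Set.toFinite A using Set.Finite.induction_on with
  | empty => simpa using IsPart.empty
  | @insert a s ha hs ih =>
    rw [Set.ncard_insert_of_notMem ha hs, Set.insert_eq, Set.union_comm]
    exact ih.union_of_disjoint (h𝒟 a) (Set.disjoint_singleton_right.2 ha)

lemma even_ncard_add [Finite E] (h𝒟 : ∀ D ∈ 𝒟, Odd D.ncard) (hA : IsPart 𝒟 n A) :
    Even (A.ncard + n) := by
  induction hA with
  | empty => simp
  | union_of_disjoint _ hD hdis ih =>
    rw [Set.ncard_union_eq hdis]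
    have := h𝒟 _ hD
    grind

/-- A subadditive function bounded on each part by a superadditive one is bounded by it on the
disjoint union. -/
lemma apply_le {f g : Set E → ℕ} (hf₀ : f ∅ = 0)
    (hf : ∀ A D : Set E, Disjoint A D → f (A ∪ D) ≤ f A + f D)
    (hg : ∀ A D : Set E, Disjoint A D → g A + g D ≤ g (A ∪ D))
    (hfg : ∀ D ∈ 𝒟, f D ≤ g D) (hA : IsPart 𝒟 n A) : f A ≤ g A := by
  induction hA with
  | empty => simp [hf₀]
  | union_of_disjoint _ hD hdis ih =>
    have h1 := hf _ _ hdis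
    have h2 := hg _ _ hdis
    have h3 := hfg _ hD
    omega

/-- `D` absorbs, one after another, the parts it meets. The bound `U` stands for the complement of a
point, which keeps all the unions formed proper. -/
lemma exists_union (hu : ∀ D ∈ 𝒟, ∀ D' ∈ 𝒟, (D ∩ D').Nonempty → D ∪ D' ⊆ U → D ∪ D' ∈ 𝒟)
    (hA : IsPart 𝒟 n A) (hD : D ∈ 𝒟) (hU : A ∪ D ⊆ U) :
    ∃ m ≤ n + 1, IsPart 𝒟 m (A ∪ D) := by
  induction hA generalizing D with
  | empty => exact ⟨1, le_rfl, by simpa using of_mem hD⟩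
  | @union_of_disjoint n A P _ hP hdis ih =>
    rw [Set.union_assoc, Set.union_subset_iff] at hU
    by_cases hPD : (P ∩ D).Nonempty
    · obtain ⟨m, hm, h⟩ := ih (hu P hP D hD hPD hU.2) (Set.union_subset hU.1 hU.2)
      exact ⟨m, by omega, by rwa [Set.union_assoc]⟩
    · obtain ⟨m, hm, h⟩ := ih hD
        (Set.union_subset hU.1 (Set.subset_union_right.trans hU.2))
      rw [Set.not_nonempty_iff_eq_empty, ← Set.disjoint_iff_inter_eq_empty] at hPD
      refine ⟨m + 1, by omega, ?_⟩
      rw [Set.union_right_comm]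
      exact h.union_of_disjoint hP (Set.disjoint_union_left.2 ⟨hdis, hPD.symm⟩)

lemma exists_sUnion
    (hu : ∀ D ∈ 𝒟, ∀ D' ∈ 𝒟, (D ∩ D').Nonempty → D ∪ D' ⊆ U → D ∪ D' ∈ 𝒟)
    (S : Finset (Set E)) (hS : (S : Set (Set E)) ⊆ 𝒟) (hU : ⋃₀ (S : Set (Set E)) ⊆ U) :
    ∃ m ≤ S.card, IsPart 𝒟 m (⋃₀ (S : Set (Set E))) := by
  classical
  induction S using Finset.induction_on with
  | empty => exact ⟨0, le_rfl, by simpa using IsPart.empty⟩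
  | insert D S hDS ih =>
    rw [Finset.coe_insert, Set.insert_subset_iff] at hS
    rw [Finset.coe_insert, Set.sUnion_insert, Set.union_comm] at hU ⊢
    obtain ⟨m, hm, h⟩ := ih hS.2 (Set.subset_union_left.trans hU)
    obtain ⟨k, hk, h'⟩ := exists_union hu h hS.1 hU
    exact ⟨k, by rw [Finset.card_insert_of_notMem hDS]; omega, h'⟩

lemma exists_of_forall_mem [Finite E]
    (hu : ∀ D ∈ 𝒟, ∀ D' ∈ 𝒟, (D ∩ D').Nonempty → D ∪ D' ∈ 𝒟)
    (hA : ∀ e ∈ A, ∃ D ∈ 𝒟, e ∈ D ∧ D ⊆ A) : ∃ n, IsPart 𝒟 n A := by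
  have hfin : {D ∈ 𝒟 | D ⊆ A}.Finite := Set.toFinite _
  obtain ⟨m, -, h⟩ := exists_sUnion (U := Set.univ)
    (fun D hD D' hD' hne _ ↦ hu D hD D' hD' hne) hfin.toFinset
    (by rw [hfin.coe_toFinset]; exact fun D hD ↦ hD.1) (Set.subset_univ _)
  rw [hfin.coe_toFinset] at h
  convert (⟨m, h⟩ : ∃ m, IsPart 𝒟 m _)
  refine (Set.Subset.antisymm (Set.sUnion_subset fun D hD ↦ hD.2) fun e he ↦ ?_).symm
  obtain ⟨D, hD, heD, hDA⟩ := hA e he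
  exact ⟨D, ⟨hD, hDA⟩, heD⟩

lemma exists_union_inter_of_mem
    (hu : ∀ D ∈ 𝒟, ∀ D' ∈ 𝒟, (D ∩ D').Nonempty → D ∪ D' ⊆ U → D ∪ D' ∈ 𝒟)
    (hi : ∀ D ∈ 𝒟, ∀ D' ∈ 𝒟, (D ∩ D').Nonempty → D ∪ D' ⊆ U → D ∩ D' ∈ 𝒟)
    (hA : IsPart 𝒟 n A) (hD : D ∈ 𝒟) (hU : A ∪ D ⊆ U) :
    ∃ a b, IsPart 𝒟 a (A ∪ D) ∧ IsPart 𝒟 b (A ∩ D) ∧ a + b ≤ n + 1 := by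
  induction hA generalizing D with
  | empty => exact ⟨1, 0, by simpa using of_mem hD, by simpa using IsPart.empty, by omega⟩
  | @union_of_disjoint n A P _ hP hdis ih =>
    rw [Set.union_assoc, Set.union_subset_iff] at hU
    by_cases hPD : (P ∩ D).Nonempty
    · obtain ⟨a, b, ha, hb, hab⟩ := ih (hu P hP D hD hPD hU.2) (Set.union_subset hU.1 hU.2)
      rw [Set.inter_union_distrib_left, hdis.inter_eq, Set.empty_union] at hb
      -- The part `P` is absorbed into `D`, which saves a part of the union and pays for the new
      -- part `P ∩ D` of the intersection.
      refine ⟨a, b + 1, by rwa [Set.union_assoc], ?_, by omega⟩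
      rw [Set.union_inter_distrib_right]
      exact hb.union_of_disjoint (hi P hP D hD hPD hU.2)
        (hdis.mono Set.inter_subset_left Set.inter_subset_left)
    · obtain ⟨a, b, ha, hb, hab⟩ := ih hD
        (Set.union_subset hU.1 (Set.subset_union_right.trans hU.2))
      rw [Set.not_nonempty_iff_eq_empty] at hPD
      refine ⟨a + 1, b, ?_, ?_, by omega⟩
      · rw [Set.union_right_comm]
        exact ha.union_of_disjoint hP (Set.disjoint_union_left.2
          ⟨hdis, (Set.disjoint_iff_inter_eq_empty.2 hPD).symm⟩)
      · rwa [Set.union_inter_distrib_right, hPD, Set.union_empty]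

/-- The least number of parts of a partition into members of a crossing family is
submodular. -/
lemma exists_union_inter
    (hu : ∀ D ∈ 𝒟, ∀ D' ∈ 𝒟, (D ∩ D').Nonempty → D ∪ D' ⊆ U → D ∪ D' ∈ 𝒟)
    (hi : ∀ D ∈ 𝒟, ∀ D' ∈ 𝒟, (D ∩ D').Nonempty → D ∪ D' ⊆ U → D ∩ D' ∈ 𝒟)
    (hA : IsPart 𝒟 m A) (hB : IsPart 𝒟 n B) (hU : A ∪ B ⊆ U) :
    ∃ a b, IsPart 𝒟 a (A ∪ B) ∧ IsPart 𝒟 b (A ∩ B) ∧ a + b ≤ m + n := by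
  induction hB with
  | empty => exact ⟨m, 0, by simpa using hA, by simpa using IsPart.empty, by omega⟩
  | @union_of_disjoint n B D _ hD hdis ih =>
    rw [← Set.union_assoc] at hU
    obtain ⟨a, b, ha, hb, hab⟩ := ih (Set.subset_union_left.trans hU)
    obtain ⟨a', b', ha', hb', hab'⟩ := exists_union_inter_of_mem hu hi ha hD hU
    refine ⟨a', b + b', by rwa [← Set.union_assoc], ?_, by omega⟩
    rw [Set.union_inter_distrib_right, hdis.inter_eq, Set.union_empty] at hb'
    rw [Set.inter_union_distrib_left]
    exact hb.union hb' (hdis.mono Set.inter_subset_right Set.inter_subset_right)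

end IsPart

/-! ### Uncrossing complements, tight sets and augmentation -/

/-- The complements of the members of `𝒢`. -/
def compls (𝒢 : Set (Set E)) : Set (Set E) := {D | Dᶜ ∈ 𝒢}

/-- The complements of the members of `𝒢`, together with all singletons. -/
def complsSingletons (𝒢 : Set (Set E)) : Set (Set E) := {D | Dᶜ ∈ 𝒢 ∨ ∃ e, D = {e}}

/-- `I` meets every nonempty `X` in at most `(|X| + n) / 2` elements, whenever the complement of
`X` is the disjoint union of `n` sets which are singletons or complements of members of `𝒢`. -/
def IsIndep (𝒢 : Set (Set E)) (I : Set E) : Prop :=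
  ∀ (n : ℕ) (X : Set E), X.Nonempty → IsPart (complsSingletons 𝒢) n Xᶜ →
    2 * (I ∩ X).ncard ≤ X.ncard + n

/-- The nonempty sets for which the bound in the definition of `IsIndep` is attained by `I`. -/
def tightSets (𝒢 : Set (Set E)) (I : Set E) : Set (Set E) :=
  {T | T.Nonempty ∧ ∃ n, IsPart (complsSingletons 𝒢) n Tᶜ ∧ T.ncard + n ≤ 2 * (I ∩ T).ncard}

variable {𝒢 : Set (Set E)} {I J A X F : Set E} {n : ℕ}

lemma singleton_mem_complsSingletons (e : E) : {e} ∈ complsSingletons 𝒢 := Or.inr ⟨e, rfl⟩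

lemma compls_subset_complsSingletons : compls 𝒢 ⊆ complsSingletons 𝒢 := fun _ h ↦ Or.inl h

lemma union_mem_compls (h𝒢 : IsG2PrimeFamily 𝒢) (x : E) :
    ∀ D ∈ compls 𝒢, ∀ D' ∈ compls 𝒢, (D ∩ D').Nonempty → D ∪ D' ⊆ {x}ᶜ →
      D ∪ D' ∈ compls 𝒢 := by
  intro D hD D' hD' ⟨y, hy⟩ hU
  have h := h𝒢.inter_mem _ hD _ hD'
  rw [← Set.compl_union, ← Set.compl_inter] at h
  exact h ⟨x, fun hx ↦ hU hx rfl⟩ fun hu ↦ (hu ▸ Set.mem_univ y : y ∈ (D ∩ D')ᶜ) hy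

lemma union_mem_complsSingletons (h𝒢 : IsG2PrimeFamily 𝒢) (x : E) :
    ∀ D ∈ complsSingletons 𝒢, ∀ D' ∈ complsSingletons 𝒢, (D ∩ D').Nonempty → D ∪ D' ⊆ {x}ᶜ →
      D ∪ D' ∈ complsSingletons 𝒢 := by
  rintro D (hD | ⟨e, rfl⟩) D' (hD' | ⟨e', rfl⟩) ⟨y, hy, hy'⟩ hU
  · exact Or.inl (union_mem_compls h𝒢 x D hD D' hD' ⟨y, hy, hy'⟩ hU)
  · obtain rfl : y = e' := hy'
    rw [Set.union_eq_left.2 (Set.singleton_subset_iff.2 hy)]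
    exact Or.inl hD
  · obtain rfl : y = e := hy
    rw [Set.union_eq_right.2 (Set.singleton_subset_iff.2 hy')]
    exact Or.inl hD'
  · obtain rfl : y = e := hy
    obtain rfl : y = e' := hy'
    rw [Set.union_self]
    exact singleton_mem_complsSingletons _

/-- The exception in the union axiom of `𝒢` is exactly the case where two complements meet in one
point; adjoining singletons removes it. -/
lemma inter_mem_complsSingletons (h𝒢 : IsG2PrimeFamily 𝒢) (x : E) :
    ∀ D ∈ complsSingletons 𝒢, ∀ D' ∈ complsSingletons 𝒢, (D ∩ D').Nonempty → D ∪ D' ⊆ {x}ᶜ →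
      D ∩ D' ∈ complsSingletons 𝒢 := by
  rintro D (hD | ⟨e, rfl⟩) D' (hD' | ⟨e', rfl⟩) ⟨y, hy, hy'⟩ hU
  · by_cases hs : ∃ e, D ∩ D' = {e}
    · exact Or.inr hs
    have h := h𝒢.union_mem _ hD _ hD'
    rw [← Set.compl_union, ← Set.compl_inter] at h
    refine Or.inl (h ⟨x, fun hx ↦ hU hx rfl⟩
      (fun hu ↦ (hu ▸ Set.mem_univ y : y ∈ (D ∩ D')ᶜ) ⟨hy, hy'⟩) fun e he ↦ hs ⟨e, ?_⟩)
    exact compl_injective he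
  · obtain rfl : y = e' := hy'
    rw [Set.inter_eq_right.2 (Set.singleton_subset_iff.2 hy)]
    exact singleton_mem_complsSingletons _
  · obtain rfl : y = e := hy
    rw [Set.inter_eq_left.2 (Set.singleton_subset_iff.2 hy')]
    exact singleton_mem_complsSingletons _
  · obtain rfl : y = e := hy
    obtain rfl : y = e' := hy'
    rw [Set.inter_self]
    exact singleton_mem_complsSingletons _

lemma odd_ncard_of_mem (h𝒢 : IsG2PrimeFamily 𝒢) {G : Set E} (hG : G ∈ 𝒢) : Odd G.ncard := by
  obtain ⟨g, hg⟩ := h𝒢.card_mem G hG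
  exact ⟨g - 1, by omega⟩

lemma isIndep_empty : IsIndep 𝒢 (∅ : Set E) := fun n X _ _ ↦ by simp

lemma singleton_mem_tightSets (h𝒢 : IsG2PrimeFamily 𝒢) {e : E} (he : e ∈ I) :
    {e} ∈ tightSets 𝒢 I := by
  refine ⟨Set.singleton_nonempty e, 1, IsPart.of_mem (Or.inl ?_), ?_⟩
  · rw [compl_compl]
    exact h𝒢.singleton_mem e
  · rw [Set.inter_eq_right.2 (Set.singleton_subset_iff.2 he)]
    simp

/-- A point of `F` lies outside all the complements, so overlapping ones can be merged without
increasing their number. -/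
lemma exists_isPart_of_isInterOf (h𝒢 : IsG2PrimeFamily 𝒢) {k : ℕ} (hF : F.Nonempty)
    (h : IsInterOf 𝒢 k F) : ∃ m ≤ k, IsPart (compls 𝒢) m Fᶜ := by
  classical
  obtain ⟨S, hS, rfl, rfl⟩ := h
  obtain ⟨x, hx⟩ := hF
  have hco : ((S.image compl : Finset (Set E)) : Set (Set E)) = compl '' (S : Set (Set E)) :=
    Finset.coe_image
  obtain ⟨m, hm, h⟩ := IsPart.exists_sUnion (union_mem_compls h𝒢 x) (S.image compl)
    (by
      rw [hco]
      rintro _ ⟨G, hG, rfl⟩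
      simpa [compls] using hS hG)
    (by
      rw [hco, ← Set.compl_sInter, Set.compl_subset_compl]
      exact Set.singleton_subset_iff.2 hx)
  rw [hco, ← Set.compl_sInter] at h
  exact ⟨m, hm.trans Finset.card_image_le, h⟩

lemma IsPart.exists_finset (h : IsPart (complsSingletons 𝒢) n A) :
    ∃ (S : Finset (Set E)) (B : Set E), (S : Set (Set E)) ⊆ 𝒢 ∧
      A = (⋂₀ (S : Set (Set E)))ᶜ ∪ B ∧ S.card + B.ncard ≤ n := by
  classical
  induction h with
  | empty => exact ⟨∅, ∅, by simp⟩
  | @union_of_disjoint n A D _ hD hdis ih =>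
    obtain ⟨S, B, hS, rfl, hle⟩ := ih
    rcases hD with hD | ⟨e, rfl⟩
    · refine ⟨insert Dᶜ S, B, ?_, ?_, ?_⟩
      · rw [Finset.coe_insert]
        exact Set.insert_subset hD hS
      · rw [Finset.coe_insert, Set.sInter_insert, Set.compl_inter, compl_compl]
        ext x; simp only [Set.mem_union]; tauto
      · have := Finset.card_insert_le Dᶜ S
        omega
    · refine ⟨S, insert e B, hS, ?_, ?_⟩
      · rw [Set.union_assoc, Set.union_singleton]
      · have := Set.ncard_insert_le e B
        omega

lemma IsPart.exists_isInterOf (h : IsPart (compls 𝒢) n Fᶜ) : ∃ k ≤ n, IsInterOf 𝒢 k F := by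
  classical
  suffices h' : ∀ {A : Set E} {n : ℕ}, IsPart (compls 𝒢) n A → ∃ k ≤ n, IsInterOf 𝒢 k Aᶜ by
    simpa using h' h
  intro A n h
  induction h with
  | empty => exact ⟨0, le_rfl, ∅, by simp⟩
  | @union_of_disjoint n A D _ hD hdis ih =>
    obtain ⟨k, hk, S, hS, rfl, hSA⟩ := ih
    refine ⟨(insert Dᶜ S).card, (Finset.card_insert_le _ _).trans (by omega), insert Dᶜ S, ?_,
      rfl, ?_⟩
    · rw [Finset.coe_insert]
      exact Set.insert_subset hD hS
    · rw [Finset.coe_insert, Set.sInter_insert, hSA, Set.compl_union, Set.inter_comm]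

lemma isPart_c (h𝒢 : IsG2PrimeFamily 𝒢) (hF : F ∈ tilde 𝒢) :
    IsPart (compls 𝒢) (c 𝒢 F) Fᶜ := by
  have hc : IsInterOf 𝒢 (c 𝒢 F) F := Nat.sInf_mem hF.2
  obtain ⟨m, hm, h⟩ := exists_isPart_of_isInterOf h𝒢 hF.1 hc
  obtain ⟨k, hk, h'⟩ := h.exists_isInterOf
  have hck : c 𝒢 F ≤ k := Nat.sInf_le h'
  rwa [show c 𝒢 F = m by omega]

lemma not_isIndep_of_isCandidate (h𝒢 : IsG2PrimeFamily 𝒢) {C : Set E}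
    (hC : IsCandidate 𝒢 C) : ¬ IsIndep 𝒢 C := by
  obtain ⟨F, hF, hCF, hr⟩ := hC
  intro hind
  have h := hind _ F hF.1 ((isPart_c h𝒢 hF).mono compls_subset_complsSingletons)
  rw [Set.inter_eq_left.2 hCF] at h
  rw [r] at hr
  have h' : 2 * (C.ncard : ℚ) ≤ F.ncard + c 𝒢 F := by exact_mod_cast h
  linarith

section Finite

variable [Finite E]

lemma even_ncard_add_ncard_compl (h𝒢 : IsG2PrimeFamily 𝒢) (A : Set E) :
    Even (A.ncard + Aᶜ.ncard) := by
  obtain ⟨g, hg⟩ := h𝒢.card_ground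
  exact ⟨g, by rw [Set.ncard_add_ncard_compl]; omega⟩

lemma odd_ncard_of_mem_complsSingletons (h𝒢 : IsG2PrimeFamily 𝒢) :
    ∀ D ∈ complsSingletons 𝒢, Odd D.ncard := by
  rintro D (hD | ⟨e, rfl⟩)
  · have h1 := odd_ncard_of_mem h𝒢 hD
    have h2 := even_ncard_add_ncard_compl h𝒢 D
    grind
  · simp

lemma IsPart.even_ncard_compl_add (h𝒢 : IsG2PrimeFamily 𝒢)
    (h : IsPart (complsSingletons 𝒢) n Aᶜ) : Even (A.ncard + n) := by
  have h1 := h.even_ncard_add (odd_ncard_of_mem_complsSingletons h𝒢)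
  have h2 := even_ncard_add_ncard_compl h𝒢 A
  grind

lemma IsIndep.subset (hJ : IsIndep 𝒢 J) (hIJ : I ⊆ J) : IsIndep 𝒢 I := fun n X hX h ↦ by
  have := hJ n X hX h
  have h' : (I ∩ X).ncard ≤ (J ∩ X).ncard :=
    Set.ncard_le_ncard (Set.inter_subset_inter_left X hIJ)
  omega

/-- Submodularity of the bound: add the two tight inequalities and subtract the independence bound
for `S ∩ T`. -/
lemma IsIndep.union_mem_tightSets (h𝒢 : IsG2PrimeFamily 𝒢) (hI : IsIndep 𝒢 I) :
    ∀ S ∈ tightSets 𝒢 I, ∀ T ∈ tightSets 𝒢 I, (S ∩ T).Nonempty → S ∪ T ∈ tightSets 𝒢 I := by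
  rintro S ⟨-, s, hs, hsI⟩ T ⟨-, t, ht, htI⟩ ⟨x, hx⟩
  obtain ⟨a, b, ha, hb, hab⟩ := IsPart.exists_union_inter (U := {x}ᶜ)
    (union_mem_complsSingletons h𝒢 x) (inter_mem_complsSingletons h𝒢 x) hs ht
    (by rw [← Set.compl_inter, Set.compl_subset_compl]; exact Set.singleton_subset_iff.2 hx)
  rw [← Set.compl_inter] at ha
  rw [← Set.compl_union] at hb
  refine ⟨⟨x, Or.inl hx.1⟩, b, hb, ?_⟩
  have h1 := hI a _ ⟨x, hx⟩ ha
  have h2 := Set.ncard_union_add_ncard_inter S T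
  have h3 := Set.ncard_union_add_ncard_inter (I ∩ S) (I ∩ T)
  rw [← Set.inter_union_distrib_left, ← Set.inter_inter_distrib_left] at h3
  omega

/-- Each element of `X \ A` becomes a singleton part, so the bound is unchanged, and `I` loses
nothing. -/
lemma inter_mem_tightSets (hX : X ∈ tightSets 𝒢 I) (hIA : I ⊆ A) (hne : (X ∩ A).Nonempty) :
    X ∩ A ∈ tightSets 𝒢 I := by
  obtain ⟨-, n, hn, hXI⟩ := hX
  have hcompl : (X ∩ A)ᶜ = Xᶜ ∪ X \ A := by
    ext x; simp only [Set.mem_compl_iff, Set.mem_inter_iff, Set.mem_union, Set.mem_sdiff]; tauto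
  refine ⟨hne, n + (X \ A).ncard, ?_, ?_⟩
  · rw [hcompl]
    exact hn.union (IsPart.of_singleton_mem singleton_mem_complsSingletons _)
      (disjoint_compl_left.mono_right Set.sdiff_subset)
  · have h1 := Set.ncard_inter_add_ncard_sdiff_eq_ncard X A
    have h2 : I ∩ (X ∩ A) = I ∩ X := by
      ext x; simp only [Set.mem_inter_iff]; exact ⟨fun h ↦ ⟨h.1, h.2.1⟩, fun h ↦ ⟨h.1, h.2, hIA h.1⟩⟩
    rw [h2]
    omega

lemma IsIndep.exists_mem_tightSets (h𝒢 : IsG2PrimeFamily 𝒢) (hI : IsIndep 𝒢 I) {e : E}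
    (he : ¬ IsIndep 𝒢 (insert e I)) : ∃ T ∈ tightSets 𝒢 I, e ∈ T := by
  simp only [IsIndep, not_forall, not_le] at he
  obtain ⟨n, X, hX, hn, hlt⟩ := he
  have h1 := hI n X hX hn
  -- By parity a violated bound is exceeded by at least 2, so removing `e` still leaves equality.
  have h2 := hn.even_ncard_compl_add h𝒢
  have heX : e ∈ X := by
    by_contra heX
    rw [Set.insert_inter_of_notMem heX] at hlt
    omega
  refine ⟨X, ⟨hX, n, hn, ?_⟩, heX⟩
  rw [Set.insert_inter_of_mem heX] at hlt
  have h3 := Set.ncard_insert_le e (I ∩ X)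
  grind

lemma IsIndep.exists_insert (h𝒢 : IsG2PrimeFamily 𝒢) (hI : IsIndep 𝒢 I) (hJ : IsIndep 𝒢 J)
    (hIJ : I.ncard < J.ncard) : ∃ e ∈ J, e ∉ I ∧ IsIndep 𝒢 (insert e I) := by
  by_contra! hcon
  have hcov : ∀ e ∈ I ∪ J, ∃ T ∈ tightSets 𝒢 I, e ∈ T := by
    intro e he
    by_cases heI : e ∈ I
    · exact ⟨_, singleton_mem_tightSets h𝒢 heI, rfl⟩
    · exact hI.exists_mem_tightSets h𝒢 (hcon e (he.resolve_left heI) heI)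
  obtain ⟨n, hn⟩ := IsPart.exists_of_forall_mem (A := ⋃₀ tightSets 𝒢 I)
    (hI.union_mem_tightSets h𝒢)
    (fun e ⟨T, hT, heT⟩ ↦ ⟨T, hT, heT, Set.subset_sUnion_of_mem hT⟩)
  have hle := hn.apply_le (f := fun A ↦ (J ∩ A).ncard) (g := fun A ↦ (I ∩ A).ncard) (by simp)
    (fun A D _ ↦ by simpa only [Set.inter_union_distrib_left] using Set.ncard_union_le _ _)
    (fun A D h ↦ by
      rw [Set.inter_union_distrib_left, Set.ncard_union_eq
        (h.mono Set.inter_subset_right Set.inter_subset_right)])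
    (fun T hT ↦ by
      obtain ⟨hT, n, hn, hTI⟩ := hT
      have := hJ n T hT hn
      omega)
  have hsub : I ∪ J ⊆ ⋃₀ tightSets 𝒢 I := hcov
  simp only [Set.inter_eq_left.2 (Set.subset_union_left.trans hsub),
    Set.inter_eq_left.2 (Set.subset_union_right.trans hsub)] at hle
  omega

/-! ### The matroid and its circuits -/

/-- The matroid of a `G'₂`-family, by its independent sets. -/
noncomputable def matroid (h𝒢 : IsG2PrimeFamily 𝒢) : Matroid E :=
  (IndepMatroid.ofFinite Set.finite_univ (IsIndep 𝒢) isIndep_empty (fun _ _ ↦ IsIndep.subset)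
    (fun _ _ ↦ IsIndep.exists_insert h𝒢) (fun _ _ ↦ Set.subset_univ _)).matroid

lemma matroid_ground (h𝒢 : IsG2PrimeFamily 𝒢) : (matroid h𝒢).E = Set.univ := rfl

lemma matroid_indep (h𝒢 : IsG2PrimeFamily 𝒢) : (matroid h𝒢).Indep I ↔ IsIndep 𝒢 I := Iff.rfl

/-- Returning the singleton parts `B` of `Xᶜ` to the set enlarges `X` to at most `X ∪ B` and drops
`|B|` parts, so the violation persists on an intersection `F` of members of `𝒢`. -/
lemma exists_isCandidate_of_not_isIndep (h𝒢 : IsG2PrimeFamily 𝒢) (hI : ¬ IsIndep 𝒢 I) :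
    ∃ C ⊆ I, IsCandidate 𝒢 C := by
  simp only [IsIndep, not_forall, not_le] at hI
  obtain ⟨n, X, hX, hn, hlt⟩ := hI
  obtain ⟨S, B, hS, hXS, hle⟩ := hn.exists_finset
  set F := ⋂₀ (S : Set (Set E)) with hFdef
  have hint : IsInterOf 𝒢 S.card F := ⟨S, hS, rfl, rfl⟩
  have hXF : X ⊆ F := by
    rw [← Set.compl_subset_compl, hXS]
    exact Set.subset_union_left
  have hFX : F ⊆ X ∪ B := by
    intro x hx
    by_contra hxn
    rw [Set.mem_union, not_or] at hxn
    have : x ∈ Fᶜ ∪ B := hXS ▸ hxn.1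
    exact this.elim (fun h ↦ h hx) hxn.2
  have hF : F ∈ tilde 𝒢 := ⟨hX.mono hXF, _, hint⟩
  have hc : c 𝒢 F ≤ S.card := Nat.sInf_le hint
  have h1 := (Set.ncard_le_ncard hFX).trans (Set.ncard_union_le X B)
  have h2 : (I ∩ X).ncard ≤ (I ∩ F).ncard :=
    Set.ncard_le_ncard (Set.inter_subset_inter_right I hXF)
  obtain ⟨q, hq⟩ :=
    ((isPart_c h𝒢 hF).mono compls_subset_complsSingletons).even_ncard_compl_add h𝒢
  obtain ⟨C, hC, hCcard⟩ := Set.exists_subset_card_eq (show q + 1 ≤ (I ∩ F).ncard by omega)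
  refine ⟨C, hC.trans Set.inter_subset_left, F, hF, hC.trans Set.inter_subset_right, ?_⟩
  have hq' : (F.ncard : ℚ) + c 𝒢 F = q + q := by exact_mod_cast hq
  rw [hCcard, r, hq']
  push_cast
  ring

lemma minimal_isCandidate_iff (h𝒢 : IsG2PrimeFamily 𝒢) {C : Set E} :
    Minimal (IsCandidate 𝒢) C ↔ Minimal (¬ IsIndep 𝒢 ·) C := by
  constructor
  · refine fun h ↦ ⟨not_isIndep_of_isCandidate h𝒢 h.prop, fun D hD hDC ↦ ?_⟩
    obtain ⟨C', hC', hcand⟩ := exists_isCandidate_of_not_isIndep h𝒢 hD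
    exact (h.le_of_le hcand (hC'.trans hDC)).trans hC'
  · intro h
    obtain ⟨C', hC', hcand⟩ := exists_isCandidate_of_not_isIndep h𝒢 h.prop
    have hCC' := h.le_of_le (not_isIndep_of_isCandidate h𝒢 hcand) hC'
    refine ⟨(Set.Subset.antisymm hC' hCC') ▸ hcand, fun D hD hDC ↦ ?_⟩
    exact h.le_of_le (not_isIndep_of_isCandidate h𝒢 hD) hDC

lemma isMatroidOf_matroid (h𝒢 : IsG2PrimeFamily 𝒢) : IsMatroidOf 𝒢 (matroid h𝒢) where
  ground_eq := rfl
  isCircuit_iff C := by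
    rw [Matroid.isCircuit_iff_minimal_not_indep (Set.subset_univ C)]
    exact (minimal_isCandidate_iff h𝒢).symm

lemma IsMatroidOf.eq_matroid (h𝒢 : IsG2PrimeFamily 𝒢) {M : Matroid E}
    (hM : IsMatroidOf 𝒢 M) : M = matroid h𝒢 :=
  Matroid.ext_isCircuit hM.ground_eq fun C _ ↦ by
    rw [hM.isCircuit_iff, (isMatroidOf_matroid h𝒢).isCircuit_iff]

lemma nonempty_of_mem (h𝒢 : IsG2PrimeFamily 𝒢) {G : Set E} (hG : G ∈ 𝒢) : G.Nonempty := by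
  rw [← Set.ncard_pos]
  exact (odd_ncard_of_mem h𝒢 hG).pos

lemma ne_univ_of_mem (h𝒢 : IsG2PrimeFamily 𝒢) {G : Set E} (hG : G ∈ 𝒢) : G ≠ Set.univ := by
  rintro rfl
  have h1 := odd_ncard_of_mem h𝒢 hG
  have h2 := even_ncard_add_ncard_compl h𝒢 (Set.univ : Set E)
  simp only [Set.compl_univ, Set.ncard_empty, add_zero] at h2
  exact (Nat.not_even_iff_odd.2 h1) h2

end Finite

end G2Prime

/-! ### Ranks and good flats -/

namespace Matroid

lemma isFlat_of_forall_natRk_lt {α : Type*} [Finite α] {M : Matroid α} {F : Set α}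
    (hF : F ⊆ M.E) (h : ∀ e ∈ M.E \ F, M.natRk F < M.natRk (insert e F)) : M.IsFlat F := by
  suffices hcl : M.closure F = F from hcl ▸ M.isFlat_closure F
  refine Set.Subset.antisymm (fun e he ↦ ?_) (M.subset_closure F)
  by_contra heF
  have hlt := h e ⟨M.closure_subset_ground F he, heF⟩
  have heq : M.eRk (insert e F) = M.eRk F := by
    rw [← M.eRk_closure_eq (insert e F), closure_insert_eq_of_mem_closure he, eRk_closure_eq]
  rw [natRk, natRk, heq] at hlt
  exact hlt.false

lemma IsFlat.natRk_lt_of_ssubset {α : Type*} [Finite α] {M : Matroid α} {F : Set α}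
    (hF : M.IsFlat F) (hFE : F ⊂ M.E) : M.natRk F < M.natRk M.E := by
  obtain ⟨e, he, heF⟩ := Set.exists_of_ssubset hFE
  have h1 := M.eRk_insert_eq_add_one (X := F) (e := e) ⟨he, by rwa [hF.closure]⟩
  have h2 := M.eRk_mono (Set.insert_subset he hFE.subset)
  rw [h1, ← cast_natRk, ← cast_natRk] at h2
  have h3 : M.natRk F + 1 ≤ M.natRk M.E := by exact_mod_cast h2
  exact h3

end Matroid

namespace G2Prime

variable {E : Type*} [Finite E] {𝒢 : Set (Set E)} {A G F I : Set E} {n : ℕ}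
  (h𝒢 : IsG2PrimeFamily 𝒢)

lemma two_mul_natRk_le (hA : A.Nonempty) (hn : IsPart (complsSingletons 𝒢) n Aᶜ) :
    2 * (matroid h𝒢).natRk A ≤ A.ncard + n := by
  obtain ⟨I, hI⟩ := (matroid h𝒢).exists_isBasis A (Set.subset_univ A)
  have h := (matroid_indep h𝒢).1 hI.indep n A hA hn
  rwa [Set.inter_eq_left.2 hI.subset, ← hI.natRk_eq] at h

lemma exists_isPart_tightSets (hI : (matroid h𝒢).IsBasis I A) :
    ∃ m, IsPart (tightSets 𝒢 I) m A := by
  have hind : IsIndep 𝒢 I := hI.indep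
  refine IsPart.exists_of_forall_mem (hind.union_mem_tightSets h𝒢) fun e he ↦ ?_
  by_cases heI : e ∈ I
  · exact ⟨_, singleton_mem_tightSets h𝒢 heI, rfl, Set.singleton_subset_iff.2 he⟩
  obtain ⟨T, hT, heT⟩ := hind.exists_mem_tightSets h𝒢 (e := e) fun h ↦
    heI ((hI.eq_of_subset_indep (J := insert e I) h (Set.subset_insert e I)
      (Set.insert_subset he hI.subset)) ▸ Set.mem_insert e I)
  exact ⟨T ∩ A, inter_mem_tightSets hT hI.subset ⟨e, heT, he⟩, ⟨heT, he⟩,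
    Set.inter_subset_right⟩

lemma ncard_le_of_isPart_tightSets (hA : IsPart (tightSets 𝒢 I) n A) :
    A.ncard ≤ 2 * (I ∩ A).ncard := by
  refine hA.apply_le (f := Set.ncard) (g := fun A ↦ 2 * (I ∩ A).ncard) (by simp)
    (fun A D _ ↦ Set.ncard_union_le _ _)
    (fun A D h ↦ ?_) (fun T hT ↦ ?_)
  · rw [Set.inter_union_distrib_left, Set.ncard_union_eq
      (h.mono Set.inter_subset_right Set.inter_subset_right)]
    omega
  · obtain ⟨-, n, -, hle⟩ := hT
    omega

lemma natRk_le_of_isPart_tightSets (hA : IsPart (tightSets 𝒢 I) n A) :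
    (matroid h𝒢).natRk A ≤ (I ∩ A).ncard := by
  refine hA.apply_le (f := (matroid h𝒢).natRk) (g := fun A ↦ (I ∩ A).ncard)
    (by simp [Matroid.natRk]) (fun A D _ ↦ (matroid h𝒢).natRk_union_le A D)
    (fun A D h ↦ ?_) (fun T hT ↦ ?_)
  · rw [Set.inter_union_distrib_left, Set.ncard_union_eq
      (h.mono Set.inter_subset_right Set.inter_subset_right)]
  · obtain ⟨hT, n, hn, hle⟩ := hT
    have := two_mul_natRk_le h𝒢 hT hn
    omega

/-- `A` splits into sets tight for a basis `I` of `A`, and a tight `T` has `|T| ≤ 2 |I ∩ T|`. -/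
lemma ncard_le_two_mul_natRk (A : Set E) : A.ncard ≤ 2 * (matroid h𝒢).natRk A := by
  obtain ⟨I, hI⟩ := (matroid h𝒢).exists_isBasis A (Set.subset_univ A)
  obtain ⟨m, hm⟩ := exists_isPart_tightSets h𝒢 hI
  have := ncard_le_of_isPart_tightSets hm
  rwa [Set.inter_eq_left.2 hI.subset, ← hI.natRk_eq] at this

lemma ncard_lt_two_mul_natRk (hA : A.Nonempty) (hAE : A ≠ Set.univ) :
    A.ncard < 2 * (matroid h𝒢).natRk A := by
  obtain ⟨I, hI⟩ := (matroid h𝒢).exists_isBasis A (Set.subset_univ A)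
  obtain ⟨m, hm⟩ := exists_isPart_tightSets h𝒢 hI
  rw [hI.natRk_eq, ← Set.inter_eq_left.2 hI.subset]
  cases hm with
  | empty => exact absurd hA Set.not_nonempty_empty
  | @union_of_disjoint n A' T hA' hT hdis =>
    have h1 := ncard_le_of_isPart_tightSets hA'
    obtain ⟨-, k, hk, hle⟩ := hT
    -- Zero parts would mean `T` is everything; so one tight part of a proper set already gives
    -- strictness.
    have hk0 : k ≠ 0 := by
      rintro rfl
      generalize hB : Tᶜ = B at hk
      cases hk
      rw [Set.compl_empty_iff] at hB
      exact hAE (by rw [hB, Set.union_univ])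
    rw [Set.inter_union_distrib_left, Set.ncard_union_eq
      (hdis.mono Set.inter_subset_right Set.inter_subset_right), Set.ncard_union_eq hdis]
    omega

lemma two_mul_natRk_univ : 2 * (matroid h𝒢).natRk Set.univ = (Set.univ : Set E).ncard := by
  refine le_antisymm ?_ (ncard_le_two_mul_natRk h𝒢 _)
  -- The independence bound speaks only of nonempty sets, so an empty ground set is separate.
  rcases isEmpty_or_nonempty E with hE | hE
  · have h := (matroid h𝒢).eRk_le_encard Set.univ
    rw [← Matroid.cast_natRk, Set.univ_eq_empty_iff.2 hE, Set.encard_empty] at h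
    have h' : (matroid h𝒢).natRk ∅ = 0 := by simpa using h
    rw [Set.univ_eq_empty_iff.2 hE, h']
    simp
  · have := two_mul_natRk_le h𝒢 (n := 0) Set.univ_nonempty (by simpa using IsPart.empty)
    simpa using this

lemma two_mul_natRk_of_mem (hG : G ∈ 𝒢) : 2 * (matroid h𝒢).natRk G = G.ncard + 1 :=
  le_antisymm
    (two_mul_natRk_le h𝒢 (nonempty_of_mem h𝒢 hG)
      (IsPart.of_mem (Or.inl (by rwa [compl_compl]))))
    (ncard_lt_two_mul_natRk h𝒢 (nonempty_of_mem h𝒢 hG) (ne_univ_of_mem h𝒢 hG))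

lemma isConnectedMatroid_matroid : IsConnectedMatroid (matroid h𝒢) := by
  refine Matroid.isConnectedMatroid_of_forall_lt _ fun A B hA hB hAB hE ↦ ?_
  rw [matroid_ground] at hE ⊢
  have h1 := two_mul_natRk_univ h𝒢
  have h2 := ncard_le_two_mul_natRk h𝒢 A
  have h3 := ncard_lt_two_mul_natRk h𝒢 hB fun h ↦ by
    obtain ⟨a, ha⟩ := hA
    exact hAB.ne_of_mem ha (h ▸ Set.mem_univ a) rfl
  have h4 := Set.ncard_union_eq hAB
  rw [hE] at h4
  omega

/-- All three properties are counts: proper nonempty sets satisfy `2 r(X) ≥ |X| + 1`, with equality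
at `G`. Flatness also needs `G` not to be the complement of a point. -/
lemma isGoodFlat_of_mem (hG : G ∈ 𝒢) : IsGoodFlat (matroid h𝒢) G := by
  have hrk := two_mul_natRk_of_mem h𝒢 hG
  have hE := two_mul_natRk_univ h𝒢
  have hGu := ne_univ_of_mem h𝒢 hG
  refine ⟨Matroid.isFlat_of_forall_natRk_lt (Set.subset_univ G) fun e he ↦ ?_,
    nonempty_of_mem h𝒢 hG, Set.ssubset_univ_iff.2 hGu, ?_, ?_⟩
  · have h1 := ncard_lt_two_mul_natRk h𝒢 (A := insert e G) (Set.insert_nonempty e G) fun h ↦ by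
      refine h𝒢.compl_singleton_notMem e ?_
      convert hG
      ext x
      have hx : x ∈ insert e G := h ▸ Set.mem_univ x
      refine ⟨fun hxe ↦ hx.resolve_left hxe, ?_⟩
      rintro hxG rfl
      exact he.2 hxG
    rw [Set.ncard_insert_of_notMem he.2] at h1
    omega
  · refine Matroid.isConnectedMatroid_of_forall_lt _ fun A B hA hB hAB hU ↦ ?_
    rw [Matroid.restrict_ground_eq] at hU ⊢
    have hAG : A ⊆ G := hU ▸ Set.subset_union_left
    have hBG : B ⊆ G := hU ▸ Set.subset_union_right
    have hres : ∀ {X : Set E}, X ⊆ G → ((matroid h𝒢) ↾ G).natRk X = (matroid h𝒢).natRk X :=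
      fun hX ↦ by rw [Matroid.natRk, Matroid.restrict_eRk_eq _ hX, Matroid.natRk]
    rw [hres hAG, hres hBG, hres subset_rfl]
    have h2 := ncard_lt_two_mul_natRk h𝒢 hA fun h ↦ hGu (Set.univ_subset_iff.1 (h ▸ hAG))
    have h3 := ncard_lt_two_mul_natRk h𝒢 hB fun h ↦ hGu (Set.univ_subset_iff.1 (h ▸ hBG))
    have h4 := Set.ncard_union_eq hAB
    rw [hU] at h4
    omega
  · refine Matroid.isConnectedMatroid_of_forall_lt _ fun A B hA hB hAB hU ↦ ?_
    rw [Matroid.contract_ground, matroid_ground, ← Set.compl_eq_univ_sdiff] at hU ⊢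
    have hAG : Disjoint A G := Set.disjoint_left.2 fun x hx ↦ by
      have : x ∈ Gᶜ := hU ▸ Or.inl hx
      exact this
    have hBG : Disjoint B G := Set.disjoint_left.2 fun x hx ↦ by
      have : x ∈ Gᶜ := hU ▸ Or.inr hx
      exact this
    have c1 := (matroid h𝒢).natRk_contract_add (Set.subset_univ G) (Set.subset_univ A) hAG
    have c2 := (matroid h𝒢).natRk_contract_add (Set.subset_univ G) (Set.subset_univ B) hBG
    have c3 := (matroid h𝒢).natRk_contract_add (Set.subset_univ G) (Set.subset_univ Gᶜ)
      disjoint_compl_left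
    rw [Set.compl_union_self] at c3
    have h2 := ncard_lt_two_mul_natRk h𝒢 (A := A ∪ G) (hA.mono Set.subset_union_left) fun h ↦ by
      obtain ⟨b, hb⟩ := hB
      have : b ∈ A ∪ G := h ▸ Set.mem_univ b
      exact this.elim (fun h ↦ hAB.ne_of_mem h hb rfl) (fun h ↦ hBG.ne_of_mem hb h rfl)
    have h3 := ncard_lt_two_mul_natRk h𝒢 (A := B ∪ G) (hB.mono Set.subset_union_left) fun h ↦ by
      obtain ⟨a, ha⟩ := hA
      have : a ∈ B ∪ G := h ▸ Set.mem_univ a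
      exact this.elim (fun h ↦ hAB.ne_of_mem ha h rfl) (fun h ↦ hAG.ne_of_mem ha h rfl)
    rw [Set.ncard_union_eq hAG] at h2
    rw [Set.ncard_union_eq hBG] at h3
    have h4 := Set.ncard_union_eq hAB
    have h5 := Set.ncard_add_ncard_compl G
    rw [hU] at h4
    rw [← Set.ncard_univ] at h5
    omega

/-- If the restriction to a proper set `F` is connected, then `F` attains the rank bound given by
some partition of its complement. -/
lemma exists_isPart_of_isConnectedMatroid_restrict (hF : F.Nonempty)
    (hcon : IsConnectedMatroid ((matroid h𝒢) ↾ F)) :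
    ∃ n, IsPart (complsSingletons 𝒢) n Fᶜ ∧ F.ncard + n ≤ 2 * (matroid h𝒢).natRk F := by
  obtain ⟨I, hI⟩ := (matroid h𝒢).exists_isBasis F (Set.subset_univ F)
  obtain ⟨m, hm⟩ := exists_isPart_tightSets h𝒢 hI
  have hrk := hI.natRk_eq
  rw [← Set.inter_eq_left.2 hI.subset] at hrk
  cases hm with
  | empty => exact absurd hF Set.not_nonempty_empty
  | @union_of_disjoint n A T hA hT hdis =>
    -- A second tight part would make rank additive over the splitting, contradicting connectedness.
    rcases A.eq_empty_or_nonempty with rfl | hne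
    · obtain ⟨-, k, hk, hle⟩ := hT
      rw [Set.empty_union] at hrk ⊢
      exact ⟨k, hk, by rwa [hrk]⟩
    · exfalso
      have hlt := hcon.natRk_lt_add hne hT.1 hdis (Matroid.restrict_ground_eq).symm
      have hres : ∀ {X : Set E}, X ⊆ A ∪ T →
          ((matroid h𝒢) ↾ (A ∪ T)).natRk X = (matroid h𝒢).natRk X :=
        fun hX ↦ by rw [Matroid.natRk, Matroid.restrict_eRk_eq _ hX, Matroid.natRk]
      rw [Matroid.restrict_ground_eq, hres Set.subset_union_left, hres Set.subset_union_right,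
        hres subset_rfl, hrk, Set.inter_union_distrib_left, Set.ncard_union_eq
        (hdis.mono Set.inter_subset_right Set.inter_subset_right)] at hlt
      have h1 := natRk_le_of_isPart_tightSets h𝒢 hA
      have h2 := natRk_le_of_isPart_tightSets h𝒢 (IsPart.of_mem hT)
      omega

lemma mem_of_isGoodFlat (hF : IsGoodFlat (matroid h𝒢) F) : F ∈ 𝒢 := by
  have hE := two_mul_natRk_univ h𝒢
  have hcF := Set.ncard_add_ncard_compl F
  rw [← Set.ncard_univ] at hcF
  obtain ⟨n, hn, hle⟩ :=
    exists_isPart_of_isConnectedMatroid_restrict h𝒢 hF.nonempty hF.restrict_connected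
  have hFlt := hF.isFlat.natRk_lt_of_ssubset hF.ssubset_ground
  rw [matroid_ground] at hFlt
  generalize hB : Fᶜ = B at hn hcF
  cases hn with
  | empty => exact absurd (Set.compl_empty_iff.1 hB) hF.ssubset_ground.ne
  | @union_of_disjoint n A D hA hD hdis =>
    rcases A.eq_empty_or_nonempty with rfl | hne
    · rw [Set.empty_union] at hB hcF
      subst hB
      rcases hD with hD | ⟨e, he⟩
      · simpa using hD
      · rw [he, Set.ncard_singleton] at hcF
        omega
    · exfalso
      have hDpos := (Set.ncard_pos (Set.toFinite D)).1
        (odd_ncard_of_mem_complsSingletons h𝒢 D hD).pos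
      have hAF : Disjoint A F := Set.disjoint_left.2 fun x hx ↦ by
        have : x ∈ Fᶜ := hB ▸ Or.inl hx
        exact this
      have hDF : Disjoint D F := Set.disjoint_left.2 fun x hx ↦ by
        have : x ∈ Fᶜ := hB ▸ Or.inr hx
        exact this
      have hlt := hF.contract_connected.natRk_lt_add hne hDpos hdis
        (by rw [← hB, Matroid.contract_ground, matroid_ground, ← Set.compl_eq_univ_sdiff])
      rw [Matroid.contract_ground, matroid_ground, ← Set.compl_eq_univ_sdiff] at hlt
      have c1 := (matroid h𝒢).natRk_contract_add (Set.subset_univ F) (Set.subset_univ A) hAF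
      have c2 := (matroid h𝒢).natRk_contract_add (Set.subset_univ F) (Set.subset_univ D) hDF
      have c3 := (matroid h𝒢).natRk_contract_add (Set.subset_univ F) (Set.subset_univ Fᶜ)
        disjoint_compl_left
      rw [Set.compl_union_self] at c3
      have e1 : (A ∪ F)ᶜ = D := by
        rw [Set.compl_union, hB, Set.inter_union_distrib_left, Set.compl_inter_self,
          Set.empty_union, Set.inter_eq_right, Set.subset_compl_iff_disjoint_left]
        exact hdis
      have e2 : (D ∪ F)ᶜ = A := by
        rw [Set.compl_union, hB, Set.inter_union_distrib_left, Set.compl_inter_self,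
          Set.union_empty, Set.inter_eq_right, Set.subset_compl_iff_disjoint_left]
        exact hdis.symm
      -- The complements of `A ∪ F` and `D ∪ F` have 1 and `n` parts, so twice their ranks sum to at
      -- most `|E| + |F| + n + 1 ≤ 2 r(E) + 2 r(F)`, making `A`, `D` a separation of the
      -- contraction.
      have h1 := two_mul_natRk_le h𝒢 (A := A ∪ F) (n := 1) (hne.mono Set.subset_union_left)
        (by rw [e1]; exact IsPart.of_mem hD)
      have h2 := two_mul_natRk_le h𝒢 (A := D ∪ F) (n := n) (hDpos.mono Set.subset_union_left)
        (by rwa [e2])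
      rw [Set.ncard_union_eq hAF] at h1
      rw [Set.ncard_union_eq hDF] at h2
      rw [Set.ncard_union_eq hdis] at hcF
      omega

end G2Prime

theorem mainTheorem7 {E : Type*} [Finite E] (𝒢 : Set (Set E)) (h𝒢 : IsG2PrimeFamily 𝒢) :
    (∃! M : Matroid E, G2Prime.IsMatroidOf 𝒢 M) ∧
    ∀ M : Matroid E, G2Prime.IsMatroidOf 𝒢 M →
      IsConnectedMatroid M ∧
      {G : Set E | IsGoodFlat M G} = 𝒢 ∧
      (∀ G ∈ 𝒢, ∀ g : ℕ, (G.ncard : ℤ) = 2 * (g : ℤ) - 1 → M.eRk G = (g : ℕ∞)) ∧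
      (∀ g₀ : ℕ, Nat.card E = 2 * g₀ → M.eRank = (g₀ : ℕ∞)) := by
  refine ⟨⟨_, G2Prime.isMatroidOf_matroid h𝒢, fun M hM ↦ hM.eq_matroid h𝒢⟩, fun M hM ↦ ?_⟩
  obtain rfl := hM.eq_matroid h𝒢
  refine ⟨G2Prime.isConnectedMatroid_matroid h𝒢, ?_, fun G hG g hg ↦ ?_, fun g hg ↦ ?_⟩
  · exact Set.Subset.antisymm (fun F ↦ G2Prime.mem_of_isGoodFlat h𝒢)
      fun G ↦ G2Prime.isGoodFlat_of_mem h𝒢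
  · have h := G2Prime.two_mul_natRk_of_mem h𝒢 hG
    rw [← Matroid.cast_natRk, show (G2Prime.matroid h𝒢).natRk G = g by omega]
  · have h := G2Prime.two_mul_natRk_univ h𝒢
    rw [Set.ncard_univ, hg] at h
    rw [← Matroid.eRk_univ_eq, ← Matroid.cast_natRk,
      show (G2Prime.matroid h𝒢).natRk Set.univ = g by omega]
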